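/- Let $R$ be a semi-primary ring (associative with identity), i.e. $R$ has a two-sided nilpotent ideal $N$ such that $R/N$ is semisimple, and suppose that every simple left $R$-module is isomorphic to a left ideal of $R$. Let $\operatorname{gldim}(R)=\sup\{\operatorname{pd}_R(M)\}$ and $\operatorname{l.Ggldim}(R)=\sup\{\operatorname{Gpd}_R(M)\}$, where $M$ ranges over all left $R$-modules, $\operatorname{pd}_R$ is the projective dimension and $\operatorname{Gpd}_R$ the Gorenstein projective dimension. Then $$\operatorname{gldim}(R)\in\{0,\infty\}\qquad\text{and}\qquad \operatorname{l.Ggldim}(R)\in\{0,\infty\}.$$ Here a left $R$-module $G$ is Gorenstein projective if there is an exact sequence $\cdots\to P_1\to P_0\to P^0\to P^1\to\cdots$ of projective left $R$-modules that remains exact under $\operatorname{Hom}_R(-,Q)$ for every projective left $R$-module $Q$, with $G\cong\operatorname{Im}(P_0\to P^0)$; and $\operatorname{Gpd}_R(M)$ is the least $n\ge 0$ for which there is an exact sequence $0\to G_n\to\cdots\to G_0\to M\to 0$ with all $G_i$ Gorenstein projective ($\infty$ if there is none). The zero module is given dimension $0$. -/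

import Mathlib

universe u

/-- A complete projective resolution: a two-sided exact sequence
`⋯ → P (i + 1 + 1) → P (i + 1) → P i → ⋯` of projective left `R`-modules that stays exact
under `Hom_R(-, Q)` for every projective left `R`-module `Q`. -/
structure IsCompleteProjectiveResolution {R : Type u} [Ring R] (P : ℤ → ModuleCat.{u} R)
    (d : ∀ i : ℤ, P (i + 1) →ₗ[R] P i) : Prop where
  projective : ∀ i : ℤ, Module.Projective R (P i)
  exact : ∀ i : ℤ, Function.Exact (d (i + 1)) (d i)
  hom_exact : ∀ (Q : Type u) [AddCommGroup Q] [Module R Q], Module.Projective R Q →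
    ∀ i : ℤ, Function.Exact (fun f : P i →ₗ[R] Q => f ∘ₗ d i)
      (fun f : P (i + 1) →ₗ[R] Q => f ∘ₗ d (i + 1))

/-- A left `R`-module is Gorenstein projective if it is isomorphic to the image of one of the
maps of a complete projective resolution (after a shift, the map `P 1 → P 0`). -/
def IsGorensteinProjective (R : Type u) [Ring R] (M : Type u) [AddCommGroup M] [Module R M] :
    Prop :=
  ∃ (P : ℤ → ModuleCat.{u} R) (d : ∀ i : ℤ, P (i + 1) →ₗ[R] P i),
    IsCompleteProjectiveResolution P d ∧ Nonempty (M ≃ₗ[R] LinearMap.range (d 0))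

/-- `Gpd_R(M) ≤ n`: there is an exact sequence `0 → G n → ⋯ → G 1 → G 0 → M → 0` of left
`R`-modules with all `G i` Gorenstein projective (written with `G i = 0` for `i > n`). -/
def HasGorensteinProjectiveDimensionLE (R : Type u) [Ring R] (M : Type u) [AddCommGroup M]
    [Module R M] (n : ℕ) : Prop :=
  ∃ (G : ℕ → ModuleCat.{u} R) (d : ∀ i : ℕ, G (i + 1) →ₗ[R] G i) (ε : G 0 →ₗ[R] M),
    (∀ i : ℕ, IsGorensteinProjective R (G i)) ∧
    (∀ i : ℕ, n < i → Subsingleton (G i)) ∧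
    (∀ i : ℕ, Function.Exact (d (i + 1)) (d i)) ∧
    Function.Exact (d 0) ε ∧ Function.Surjective ε

/-- The Gorenstein projective dimension `Gpd_R(M)`: the least length of a resolution by Gorenstein
projective modules, and `⊤` if there is no finite one. -/
noncomputable def gorensteinProjectiveDimension (R : Type u) [Ring R] (M : Type u)
    [AddCommGroup M] [Module R M] : ℕ∞ :=
  ⨅ (n : ℕ) (_ : HasGorensteinProjectiveDimensionLE R M n), (n : ℕ∞)

/-- The left Gorenstein global dimension: the supremum of `Gpd_R(M)` over all left
`R`-modules `M`. -/
noncomputable def leftGorensteinGlobalDimension (R : Type u) [Ring R] : ℕ∞ :=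
  ⨆ M : ModuleCat.{u} R, gorensteinProjectiveDimension R M

/-- The (left) global dimension: the supremum of `pd_R(M)` over all left `R`-modules `M`.
Mathlib gives the zero module the projective dimension `⊥`; here it counts as `0`. -/
noncomputable def leftGlobalDimension (R : Type u) [Ring R] : ℕ∞ :=
  ⨆ M : ModuleCat.{u} R, (CategoryTheory.projectiveDimension M).unbotD 0

/-!
The key fact is that over a semiprimary ring `R` whose simple modules are all left ideals, a module
of finite injective dimension is injective (`injective_of_hasInjectiveDimensionLT`). Dimension
shifting reduces this to a module `N` with an injective coresolution `0 → N → E → E' → 0`. Any map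
from a simple module `S ⊆ R` to `E'` extends to `R` and so lifts to `E`; that is, `Ext¹(S, N) = 0`.
As nonzero modules over `R` have simple submodules, Zorn's lemma turns this into injectivity of `N`
(`IsSemiprimaryRing.injective_of_simple_lifting`).

If the global dimension is finite, every module has finite injective dimension, hence is injective,
so every module is projective and the global dimension is `0`.

If the Gorenstein global dimension is at most `n`, then `Ext^k(M, Q) = 0` for all `M`, all
projective `Q` and all `k > n` (`HasGorensteinProjectiveDimensionLE.subsingleton_ext`), so projective
modules have finite injective dimension and are injective. The socle of a module `M` is essential and
embeds in a free module; this free module being injective, the embedding extends to an embedding of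
`M` (`exists_injective_linearMap_to_projective`). Splicing projective resolutions with coresolutions
obtained in this way gives two-sided exact sequences, which stay exact under `Hom(-, Q)` because `Q`
is injective. Hence every module is Gorenstein projective
(`isGorensteinProjective_of_projective_injective`), and the Gorenstein global dimension is `0`.
-/

/-! ### Simple submodules and injective modules over semiprimary rings -/

/-- A nonzero module over a semiprimary ring has a simple submodule: the last nonzero term of its
filtration by powers of the Jacobson radical is semisimple. -/
theorem IsSemiprimaryRing.exists_isSimpleModule (R : Type*) [Ring R] [IsSemiprimaryRing R]
    (M : Type u) [AddCommGroup M] [Module R M] [Nontrivial M] :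
    ∃ S : Submodule R M, IsSimpleModule R S := by
  suffices Nontrivial M → ∃ S : Submodule R M, IsSimpleModule R S from this ‹_›
  refine IsSemiprimaryRing.induction R R M
    (P := fun M ↦ Nontrivial M → ∃ S : Submodule R M, IsSimpleModule R S) ?_ ?_
  · intro M _ _ _ _ _ _ _
    exact IsSemisimpleModule.exists_simple_submodule R M
  · intro M _ _ _ _ N hN hQ hM
    by_cases h : Nontrivial N
    · obtain ⟨S, hS⟩ := hN h
      exact ⟨S.map N.subtype,
        IsSimpleModule.congr (S.equivMapOfInjective _ N.injective_subtype).symm⟩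
    · have e := N.quotEquivOfEqBot (by simpa [Submodule.nontrivial_iff_ne_bot] using h)
      obtain ⟨S, hS⟩ := hQ e.toEquiv.nontrivial
      exact ⟨S.map e.toLinearMap,
        IsSimpleModule.congr (S.equivMapOfInjective _ e.injective).symm⟩

/-- If `0 → N → E → E'` is exact with `E` injective, and every map from a simple module to `E'`
lifts to `E`, then `N` is injective. The lifting condition says that `Ext¹(S, N)` vanishes for
all simple `S`; over a semiprimary ring a maximal partial extension of a map to `N` is therefore
total, since otherwise it could be extended across a simple submodule of the quotient by its
domain. -/
theorem IsSemiprimaryRing.injective_of_simple_lifting {R : Type*} [Ring R] [IsSemiprimaryRing R]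
    {N E E' : Type u} [AddCommGroup N] [Module R N] [AddCommGroup E] [Module R E]
    [AddCommGroup E'] [Module R E'] [hE : Module.Injective R E] {f : N →ₗ[R] E} {p : E →ₗ[R] E'}
    (hf : Function.Injective f) (hfp : Function.Exact f p)
    (hlift : ∀ (S : Type u) [AddCommGroup S] [Module R S] [IsSimpleModule R S] (g : S →ₗ[R] E'),
      ∃ g' : S →ₗ[R] E, p ∘ₗ g' = g) :
    Module.Injective R N := by
  constructor
  intro X Y _ _ _ _ i hi φ
  have : Fact (Function.Injective i) := ⟨hi⟩
  set m := Module.Baer.extensionOfMax i φ with hm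
  set D := m.domain with hD
  suffices htop : D = ⊤ by
    refine ⟨m.toFun ∘ₗ LinearMap.codRestrict D LinearMap.id (by simp [htop]), fun x ↦ ?_⟩
    exact (m.is_extension x).symm
  by_contra hne
  have : Nontrivial (Y ⧸ D) := Submodule.Quotient.nontrivial_iff.mpr hne
  obtain ⟨S, hS⟩ := IsSemiprimaryRing.exists_isSimpleModule R (Y ⧸ D)
  obtain ⟨u, hu⟩ := hE.out D.subtype D.injective_subtype (f ∘ₗ m.toFun)
  have hker : D ≤ LinearMap.ker (p ∘ₗ u) := fun y hy ↦ by
    have := hu ⟨y, hy⟩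
    simp only [Submodule.subtype_apply] at this
    simp [this, hfp.apply_apply_eq_zero]
  obtain ⟨v, hv⟩ := hlift S (D.liftQ _ hker ∘ₗ S.subtype)
  -- The extension across the preimage `D'` of `S` is first built with values in `E`.
  set D' := S.comap D.mkQ with hD'
  have hle : D ≤ D' := fun y hy ↦ by simp [D', (Submodule.Quotient.mk_eq_zero D).mpr hy]
  let w : D' →ₗ[R] E := u ∘ₗ D'.subtype - v ∘ₗ (D.mkQ.restrict (p := D') (q := S) fun y hy ↦ hy)
  have hw (y : D') : w y ∈ LinearMap.range f := by
    have h1 := LinearMap.congr_fun hv (D.mkQ.restrict (p := D') (q := S) (fun y hy ↦ hy) y)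
    refine (hfp _).mp ?_
    simp only [LinearMap.comp_apply] at h1
    simp only [w, LinearMap.sub_apply, map_sub, LinearMap.comp_apply, h1]
    simp
  let h' : D' →ₗ[R] N := (LinearEquiv.ofInjective f hf).symm ∘ₗ w.codRestrict _ hw
  have hfh' (y : D') : f (h' y) = w y := by
    exact congrArg Subtype.val
      ((LinearEquiv.ofInjective f hf).apply_symm_apply (w.codRestrict _ hw y))
  have hext (y : Y) (hy : y ∈ D) (hy' : y ∈ D') : h' ⟨y, hy'⟩ = m.toFun ⟨y, hy⟩ := by
    apply hf
    rw [hfh']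
    have h0 : D.mkQ.restrict (p := D') (q := S) (fun y hy ↦ hy) ⟨y, hy'⟩ = 0 :=
      Subtype.ext ((Submodule.Quotient.mk_eq_zero D).mpr hy)
    have := hu ⟨y, hy⟩
    simp only [w, LinearMap.sub_apply, LinearMap.comp_apply, h0, map_zero, sub_zero]
    exact this
  let m' : Module.Baer.ExtensionOf i φ :=
    { domain := D'
      toFun := h'
      le := m.le.trans hle
      is_extension := fun x ↦ (m.is_extension x).trans (hext _ _ _).symm }
  have hmm' : m ≤ m' := ⟨hle, fun x y hxy ↦ by
    obtain ⟨x, hx⟩ := x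
    obtain ⟨y, hy⟩ := y
    obtain rfl : x = y := hxy
    exact (hext x hx hy).symm⟩
  have heq := Module.Baer.extensionOfMax_is_max i φ m' hmm'
  have hDD' : D' = D := congrArg (fun a ↦ a.domain) heq
  have : S = ⊥ := by
    rw [← Submodule.map_comap_eq_of_surjective D.mkQ_surjective S, ← hD', hDD',
      Submodule.mkQ_map_self]
  exact (S.nontrivial_iff_ne_bot.mp (IsSimpleModule.nontrivial R S)) this

/-- If every simple module is a left ideal, then maps from simple modules lift along every
surjection `E → E'` onto an injective module: extend them to `R` and lift there. -/
theorem exists_lift_of_isSimpleModule {R : Type u} [Ring R]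
    (hR : ∀ (C : Type u) [AddCommGroup C] [Module R C], IsSimpleModule R C →
      ∃ I : Ideal R, Nonempty (C ≃ₗ[R] I))
    {E E' : Type u} [AddCommGroup E] [Module R E] [AddCommGroup E'] [Module R E']
    [hE' : Module.Injective R E'] {p : E →ₗ[R] E'} (hp : Function.Surjective p)
    (S : Type u) [AddCommGroup S] [Module R S] [IsSimpleModule R S] (g : S →ₗ[R] E') :
    ∃ g' : S →ₗ[R] E, p ∘ₗ g' = g := by
  obtain ⟨I, ⟨e⟩⟩ := hR S ‹_›
  obtain ⟨g₁, hg₁⟩ := hE'.out (I.subtype ∘ₗ e.toLinearMap)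
    (I.injective_subtype.comp e.injective) g
  obtain ⟨g₂, hg₂⟩ := Module.projective_lifting_property p g₁ hp
  refine ⟨g₂ ∘ₗ I.subtype ∘ₗ e.toLinearMap, ?_⟩
  rw [← LinearMap.comp_assoc, hg₂]
  exact LinearMap.ext hg₁

open CategoryTheory in
/-- Over a semiprimary ring whose simple modules are left ideals, a module of finite injective
dimension is injective. By dimension shifting it suffices to treat `0 → N → I → C → 0` with `I` and
`C` injective, where maps from simple modules to `C` lift to `I`. -/
theorem injective_of_hasInjectiveDimensionLT {R : Type u} [Ring R] [IsSemiprimaryRing R]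
    (hR : ∀ (C : Type u) [AddCommGroup C] [Module R C], IsSimpleModule R C →
      ∃ I : Ideal R, Nonempty (C ≃ₗ[R] I))
    (n : ℕ) (N : ModuleCat.{u} R) (hN : HasInjectiveDimensionLT N (n + 1)) :
    Module.Injective R N := by
  induction n generalizing N with
  | zero =>
    rw [zero_add, ← injective_iff_hasInjectiveDimensionLT_one] at hN
    exact Module.injective_module_of_injective_object R N
  | succ n ih =>
    let ⟨I, _, f, _⟩ := EnoughInjectives.presentation N
    have hI : Module.Injective R I := Module.injective_module_of_injective_object R I
    have injf : Function.Injective f.hom := (ModuleCat.mono_iff_injective f).mp ‹_›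
    let S : ShortComplex (ModuleCat.{u} R) :=
      ModuleCat.shortComplexOfCompEqZero _ _ f.hom.exact_map_mkQ_range.linearMap_comp_eq_zero
    have exactS := ModuleCat.shortComplex_shortExact S
      f.hom.exact_map_mkQ_range injf (Submodule.mkQ_surjective _)
    have : Module.Injective R (I ⧸ LinearMap.range f.hom) :=
      ih (ModuleCat.of R (I ⧸ LinearMap.range f.hom))
        ((exactS.hasInjectiveDimensionLT_X₃_iff n inferInstance).mpr hN)
    exact IsSemiprimaryRing.injective_of_simple_lifting injf f.hom.exact_map_mkQ_range
      fun S _ _ _ g ↦ exists_lift_of_isSimpleModule hR (Submodule.mkQ_surjective _) S g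

/-- If every simple module is a left ideal and projective modules are injective, every module
embeds in a projective one: its socle, an essential submodule, embeds in a free module, and the
embedding extends. -/
theorem exists_injective_linearMap_to_projective {R : Type u} [Ring R] [IsSemiprimaryRing R]
    (hR : ∀ (C : Type u) [AddCommGroup C] [Module R C], IsSimpleModule R C →
      ∃ I : Ideal R, Nonempty (C ≃ₗ[R] I))
    (hinj : ∀ (Q : Type u) [AddCommGroup Q] [Module R Q], Module.Projective R Q →
      Module.Injective R Q)
    (M : Type u) [AddCommGroup M] [Module R M] :
    ∃ (P : ModuleCat.{u} R) (f : M →ₗ[R] P), Module.Projective R P ∧ Function.Injective f := by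
  classical
  let soc : Submodule R M := ⨆ S ∈ {S : Submodule R M | IsSimpleModule R S}, S
  have hsoc : IsSemisimpleModule R soc :=
    isSemisimpleModule_biSup_of_isSemisimpleModule_submodule fun S (hS : IsSimpleModule R S) ↦
      inferInstance
  obtain ⟨s, e, hs⟩ := isSemisimpleModule_iff_exists_linearEquiv_dfinsupp.mp hsoc
  choose I hI using fun T : s ↦ hR T.1 (hs T)
  let j : (Π₀ T : s, T.1) →ₗ[R] Π₀ _ : s, R :=
    DFinsupp.mapRange.linearMap fun T ↦ (I T).subtype ∘ₗ (hI T).some.toLinearMap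
  have hj : Function.Injective j := by
    refine (DFinsupp.mapRange_injective _ fun _ ↦ map_zero _).mpr fun T ↦ ?_
    exact (I T).injective_subtype.comp (hI T).some.injective
  have hF : Module.Projective R (Π₀ _ : s, R) := inferInstance
  obtain ⟨f, hf⟩ := (hinj _ hF).out soc.subtype soc.injective_subtype (j ∘ₗ e.toLinearMap)
  refine ⟨ModuleCat.of R (Π₀ _ : s, R), f, hF, ?_⟩
  rw [← LinearMap.ker_eq_bot]
  by_contra hker
  have : Nontrivial (LinearMap.ker f) := Submodule.nontrivial_iff_ne_bot.mpr hker
  obtain ⟨S, hS⟩ := IsSemiprimaryRing.exists_isSimpleModule R (LinearMap.ker f)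
  have hS' : IsSimpleModule R (S.map (LinearMap.ker f).subtype) :=
    IsSimpleModule.congr (S.equivMapOfInjective _ (LinearMap.ker f).injective_subtype).symm
  have hle : S.map (LinearMap.ker f).subtype ≤ soc :=
    le_biSup (fun S : Submodule R M ↦ S)
      (show _ ∈ {S : Submodule R M | IsSimpleModule R S} from hS')
  have := IsSimpleModule.nontrivial R S
  obtain ⟨x, hx⟩ := exists_ne (0 : S)
  have hxs : (x : M) ∈ soc := hle (Submodule.mem_map_of_mem x.2)
  have h0 : j (e ⟨x, hxs⟩) = 0 := (hf ⟨x, hxs⟩).symm.trans x.1.2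
  rw [map_eq_zero_iff j hj, map_eq_zero_iff e e.injective] at h0
  have hx0 : ((x : LinearMap.ker f) : M) = 0 := congrArg Subtype.val h0
  exact hx (Subtype.ext (Subtype.ext hx0))

/-! ### Vanishing of `Ext` on modules of finite Gorenstein projective dimension -/

section ExtVanishing

open CategoryTheory Abelian

variable {R : Type u} [Ring R]

/-- Dimension shifting along `0 → A → B → C → 0`: the long exact sequence places `Ext^(n+1)(C, Q)`
between `Ext^n(A, Q)` and `Ext^(n+1)(B, Q)`. -/
theorem subsingleton_ext_of_exact {A B C : ModuleCat.{u} R} {f : A →ₗ[R] B} {g : B →ₗ[R] C}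
    (hf : Function.Injective f) (hfg : Function.Exact f g) (hg : Function.Surjective g)
    {Q : ModuleCat.{u} R} {n : ℕ} (hA : Subsingleton (Ext A Q n))
    (hB : Subsingleton (Ext B Q (n + 1))) : Subsingleton (Ext C Q (n + 1)) := by
  let S := ModuleCat.shortComplexOfCompEqZero f g hfg.linearMap_comp_eq_zero
  have hS : S.ShortExact := ModuleCat.shortComplex_shortExact S hfg hf hg
  refine subsingleton_of_forall_eq 0 fun x ↦ ?_
  obtain ⟨y, rfl⟩ := Ext.contravariant_sequence_exact₃ hS Q x
    (Subsingleton.elim (α := Ext B Q _) _ _) (add_comm 1 n)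
  rw [Subsingleton.elim (α := Ext A Q n) y 0, Ext.comp_zero]

/-- If `0 → A → B → C → 0` is exact, `Ext¹(B, Q) = 0` and all maps `A → Q` extend to `B`, then
`Ext¹(C, Q) = 0`. -/
theorem subsingleton_ext_one_of_exact {A B C : ModuleCat.{u} R} {f : A →ₗ[R] B} {g : B →ₗ[R] C}
    (hf : Function.Injective f) (hfg : Function.Exact f g) (hg : Function.Surjective g)
    {Q : ModuleCat.{u} R} (hext : ∀ φ : A →ₗ[R] Q, ∃ ψ : B →ₗ[R] Q, ψ ∘ₗ f = φ)
    (hB : Subsingleton (Ext B Q 1)) : Subsingleton (Ext C Q 1) := by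
  let S := ModuleCat.shortComplexOfCompEqZero f g hfg.linearMap_comp_eq_zero
  have hS : S.ShortExact := ModuleCat.shortComplex_shortExact S hfg hf hg
  refine subsingleton_of_forall_eq 0 fun x ↦ ?_
  obtain ⟨y, rfl⟩ := Ext.contravariant_sequence_exact₃ hS Q x
    (Subsingleton.elim (α := Ext B Q _) _ _) (add_zero 1)
  obtain ⟨φ, rfl⟩ := Ext.addEquiv₀.symm.surjective y
  obtain ⟨ψ, hψ⟩ := hext φ.hom
  have hφ : φ = S.f ≫ ModuleCat.ofHom ψ := ModuleCat.hom_ext hψ.symm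
  simp only [Ext.addEquiv₀_symm_apply]
  rw [hφ, ← Ext.mk₀_comp_mk₀, hS.extClass_comp_assoc]

/-- The images in a complete projective resolution satisfy `Ext^(k+1)(-, Q) = 0` for projective
`Q`: exactness of `Hom(-, Q)` gives the case `k = 0`, and the other cases follow by passing to
the next image. -/
theorem IsCompleteProjectiveResolution.subsingleton_ext {P : ℤ → ModuleCat.{u} R}
    {d : ∀ i : ℤ, P (i + 1) →ₗ[R] P i} (h : IsCompleteProjectiveResolution P d)
    (Q : ModuleCat.{u} R) [Module.Projective R Q] (k : ℕ) (i : ℤ) (M : ModuleCat.{u} R)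
    (e : M ≃ₗ[R] LinearMap.range (d i)) : Subsingleton (Ext M Q (k + 1)) := by
  let f : ModuleCat.of R (LinearMap.range (d (i + 1))) →ₗ[R] P (i + 1) :=
    (LinearMap.range (d (i + 1))).subtype
  let g : P (i + 1) →ₗ[R] M := e.symm ∘ₗ (d i).rangeRestrict
  have hf : Function.Injective f := Subtype.val_injective
  have hg : Function.Surjective g := e.symm.surjective.comp (d i).surjective_rangeRestrict
  have hfg : Function.Exact f g := by
    intro x
    have h1 : g x = 0 ↔ d i x = 0 := by
      simp [g, ← Subtype.val_inj]
    rw [h1, h.exact i x]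
    exact ⟨fun ⟨y, hy⟩ ↦ ⟨⟨x, y, hy⟩, rfl⟩, fun ⟨⟨_, y, hy⟩, hx⟩ ↦ ⟨y, hy.trans hx⟩⟩
  have := h.projective (i + 1)
  have hP (k : ℕ) : Subsingleton (Ext (P (i + 1)) Q (k + 1)) :=
    subsingleton_of_forall_eq 0 Ext.eq_zero_of_projective
  match k with
  | 0 =>
    refine subsingleton_ext_one_of_exact hf hfg hg (fun φ ↦ ?_) (hP 0)
    obtain ⟨ψ, hψ⟩ := (h.hom_exact Q ‹_› (i + 1) (φ ∘ₗ (d (i + 1)).rangeRestrict)).mp (by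
      ext x
      have : (d (i + 1)).rangeRestrict (d (i + 1 + 1) x) = 0 :=
        Subtype.ext ((h.exact (i + 1)).apply_apply_eq_zero x)
      simp [this])
    refine ⟨ψ, LinearMap.ext fun x ↦ ?_⟩
    obtain ⟨_, y, rfl⟩ := x
    exact LinearMap.congr_fun hψ y
  | k + 1 =>
    exact subsingleton_ext_of_exact hf hfg hg
      (h.subsingleton_ext Q k (i + 1) _ (LinearEquiv.refl R _)) (hP (k + 1))

theorem IsGorensteinProjective.subsingleton_ext {M : ModuleCat.{u} R}
    (h : IsGorensteinProjective R M) (Q : ModuleCat.{u} R) [Module.Projective R Q] (k : ℕ) :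
    Subsingleton (Ext M Q (k + 1)) := by
  obtain ⟨P, d, hPd, ⟨e⟩⟩ := h
  exact hPd.subsingleton_ext Q k 0 M e

/-- A module with a resolution by modules `G i` such that `Ext^k(G i, Q) = 0` for `k > 0` and
`G i = 0` for `n ≤ i` satisfies `Ext^k(M, Q) = 0` for `n ≤ k`. -/
theorem subsingleton_ext_of_resolution (Q : ModuleCat.{u} R) (n : ℕ) (M : ModuleCat.{u} R)
    (G : ℕ → ModuleCat.{u} R) (d : ∀ i : ℕ, G (i + 1) →ₗ[R] G i) (ε : G 0 →ₗ[R] M)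
    (hG : ∀ i k : ℕ, Subsingleton (Ext (G i) Q (k + 1)))
    (hn : ∀ i : ℕ, n ≤ i → Subsingleton (G i))
    (hd : ∀ i : ℕ, Function.Exact (d (i + 1)) (d i)) (hε : Function.Exact (d 0) ε)
    (hs : Function.Surjective ε) (k : ℕ) (hk : n ≤ k) : Subsingleton (Ext M Q k) := by
  induction n generalizing M G k with
  | zero =>
    have := hn 0 le_rfl
    have : Subsingleton M := hs.subsingleton
    have := (ModuleCat.isZero_of_subsingleton M).hasProjectiveDimensionLT_zero
    exact subsingleton_of_forall_eq 0 fun x ↦ x.eq_zero_of_hasProjectiveDimensionLT 0 k.zero_le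
  | succ n ih =>
    obtain _ | k := k
    · omega
    let ε' : G 1 →ₗ[R] ModuleCat.of R (LinearMap.ker ε) :=
      (d 0).codRestrict _ hε.apply_apply_eq_zero
    have hK : Subsingleton (Ext (ModuleCat.of R (LinearMap.ker ε)) Q k) := by
      refine ih _ (fun i ↦ G (i + 1)) (fun i ↦ d (i + 1)) ε' (fun i ↦ hG (i + 1))
        (fun i hi ↦ hn (i + 1) (by omega)) (fun i ↦ hd (i + 1)) (fun x ↦ ?_) (fun x ↦ ?_) k
        (by omega)
      · rw [← hd 0 x, ← Subtype.val_inj]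
        rfl
      · obtain ⟨y, hy⟩ := (hε x.1).mp x.2
        exact ⟨y, Subtype.ext hy⟩
    exact subsingleton_ext_of_exact (A := ModuleCat.of R (LinearMap.ker ε))
      (LinearMap.ker ε).injective_subtype ε.exact_subtype_ker_map hs hK (hG 0 k)

theorem HasGorensteinProjectiveDimensionLE.subsingleton_ext {M : ModuleCat.{u} R} {n : ℕ}
    (h : HasGorensteinProjectiveDimensionLE R M n) (Q : ModuleCat.{u} R) [Module.Projective R Q]
    (k : ℕ) (hk : n < k) : Subsingleton (Ext M Q k) := by
  obtain ⟨G, d, ε, hG, hn, hd, hε, hs⟩ := h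
  exact subsingleton_ext_of_resolution Q (n + 1) M G d ε (fun i ↦ (hG i).subsingleton_ext Q) hn
    hd hε hs k hk

theorem HasGorensteinProjectiveDimensionLE.mono {M : Type u} [AddCommGroup M] [Module R M]
    {m n : ℕ} (h : HasGorensteinProjectiveDimensionLE R M m) (hmn : m ≤ n) :
    HasGorensteinProjectiveDimensionLE R M n := by
  obtain ⟨G, d, ε, hG, hm, hd, hε, hs⟩ := h
  exact ⟨G, d, ε, hG, fun i hi ↦ hm i (hmn.trans_lt hi), hd, hε, hs⟩

theorem hasGorensteinProjectiveDimensionLE_of_gorensteinProjectiveDimension_le {M : Type u}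
    [AddCommGroup M] [Module R M] {n : ℕ} (h : gorensteinProjectiveDimension R M ≤ n) :
    HasGorensteinProjectiveDimensionLE R M n := by
  have h' : gorensteinProjectiveDimension R M < (n + 1 : ℕ) :=
    h.trans_lt (by exact_mod_cast n.lt_succ_self)
  simp only [gorensteinProjectiveDimension, iInf_lt_iff] at h'
  obtain ⟨m, hm, hmn⟩ := h'
  exact hm.mono (Nat.lt_succ_iff.mp (by exact_mod_cast hmn))

end ExtVanishing

/-! ### Complete projective resolutions when projective modules are injective -/

/-- A relation that is total on both sides links the members of some sequence indexed by `ℤ` and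
passing through a given element at index `1`. -/
theorem exists_int_seq_of_total {α : Type*} {r : α → α → Prop} (hl : ∀ b, ∃ a, r a b)
    (hr : ∀ a, ∃ b, r a b) (a : α) : ∃ Z : ℤ → α, Z 1 = a ∧ ∀ i, r (Z (i + 1)) (Z i) := by
  choose l hl using hl
  choose s hs using hr
  let W : ℤ → α := fun i ↦ match i with
    | Int.ofNat n => l^[n] a
    | Int.negSucc n => s^[n + 1] a
  have hW (i : ℤ) : r (W (i + 1)) (W i) := by
    match i with
    | Int.ofNat n =>
      change r (l^[n + 1] a) (l^[n] a)
      rw [Function.iterate_succ_apply']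
      exact hl _
    | Int.negSucc 0 => exact hs a
    | Int.negSucc (n + 1) =>
      change r (s^[n + 1] a) (s^[n + 1 + 1] a)
      rw [Function.iterate_succ_apply' s (n + 1)]
      exact hs _
  refine ⟨fun i ↦ W (i - 1), rfl, fun i ↦ ?_⟩
  have := hW (i - 1)
  rwa [show i - 1 + 1 = i + 1 - 1 by ring] at this

/-- If projective modules are injective and every module embeds in a projective one, then every
module is Gorenstein projective: syzygies and cosyzygies give a two-sided resolution, and
`Hom(-, Q)` is exact for the injective modules `Q`. -/
theorem isGorensteinProjective_of_projective_injective {R : Type u} [Ring R]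
    (hinj : ∀ (Q : Type u) [AddCommGroup Q] [Module R Q], Module.Projective R Q →
      Module.Injective R Q)
    (hemb : ∀ (M : Type u) [AddCommGroup M] [Module R M],
      ∃ (P : ModuleCat.{u} R) (f : M →ₗ[R] P), Module.Projective R P ∧ Function.Injective f)
    (M : Type u) [AddCommGroup M] [Module R M] : IsGorensteinProjective R M := by
  let r (A B : ModuleCat.{u} R) : Prop := ∃ (P : ModuleCat.{u} R) (f : A →ₗ[R] P) (g : P →ₗ[R] B),
    Module.Projective R P ∧ Function.Injective f ∧ Function.Exact f g ∧ Function.Surjective g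
  have hl (B : ModuleCat.{u} R) : ∃ A, r A B := by
    let g : (B →₀ R) →ₗ[R] B := Finsupp.linearCombination R id
    exact ⟨ModuleCat.of R (LinearMap.ker g), ModuleCat.of R (B →₀ R), (LinearMap.ker g).subtype, g,
      (inferInstance : Module.Projective R (B →₀ R)), (LinearMap.ker g).injective_subtype,
      g.exact_subtype_ker_map, Finsupp.linearCombination_id_surjective R B⟩
  have hr (A : ModuleCat.{u} R) : ∃ B, r A B := by
    obtain ⟨P, f, hP, hf⟩ := hemb A
    exact ⟨ModuleCat.of R (P ⧸ LinearMap.range f), P, f, (LinearMap.range f).mkQ, hP, hf,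
      f.exact_map_mkQ_range, Submodule.mkQ_surjective _⟩
  obtain ⟨Z, hZ1, hZ⟩ := exists_int_seq_of_total hl hr (ModuleCat.of R M)
  choose P f g hP hf hfg hg using hZ
  refine ⟨P, fun i ↦ f i ∘ₗ g (i + 1), ⟨hP, fun i x ↦ ?_, fun Q _ _ hQ i φ ↦ ?_⟩, ⟨?_⟩⟩
  · simp only [LinearMap.comp_apply, map_eq_zero_iff (f i) (hf i)]
    rw [hfg (i + 1) x]
    simp only [Set.mem_range, LinearMap.comp_apply]
    exact ((hg (i + 1 + 1)).exists (p := fun y ↦ f (i + 1) y = x))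
  · constructor
    · intro hφ
      have hφ0 : φ ∘ₗ f (i + 1) = 0 := by
        ext z
        obtain ⟨y, rfl⟩ := hg (i + 1 + 1) z
        exact LinearMap.congr_fun hφ y
      -- `φ` vanishes on the image of `f (i + 1)`, so it factors through `Z (i + 1)`, and from
      -- there it extends to `P i` as `Q` is injective.
      obtain ⟨ψ, hψ⟩ : ∃ ψ : Z (i + 1) →ₗ[R] Q, ψ ∘ₗ g (i + 1) = φ := by
        have hle : LinearMap.ker (g (i + 1)) ≤ LinearMap.ker φ := fun x hx ↦ by
          obtain ⟨z, rfl⟩ := (hfg (i + 1) x).mp hx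
          exact LinearMap.congr_fun hφ0 z
        refine ⟨(LinearMap.ker (g (i + 1))).liftQ φ hle ∘ₗ
          ((g (i + 1)).quotKerEquivOfSurjective (hg (i + 1))).symm, LinearMap.ext fun x ↦ ?_⟩
        have : ((g (i + 1)).quotKerEquivOfSurjective (hg (i + 1))).symm (g (i + 1) x) =
            Submodule.Quotient.mk x := by
          rw [LinearEquiv.symm_apply_eq]
          rfl
        simp [this]
      obtain ⟨χ, hχ⟩ := (hinj Q hQ).out (f i) (hf i) ψ
      refine ⟨χ, ?_⟩
      rw [← hψ]
      exact LinearMap.ext fun x ↦ hχ _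
    · rintro ⟨χ, rfl⟩
      refine LinearMap.ext fun x ↦ ?_
      simp [(hfg (i + 1)).apply_apply_eq_zero]
  · have hrange : LinearMap.range (f 0 ∘ₗ g (0 + 1)) = LinearMap.range (f 0) := by
      rw [LinearMap.range_comp, LinearMap.range_eq_top.mpr (hg _), Submodule.map_top]
    exact (CategoryTheory.eqToIso hZ1.symm).toLinearEquiv.trans
      ((LinearEquiv.ofInjective (f 0) (hf 0)).trans (LinearEquiv.ofEq _ _ hrange.symm))

theorem gorensteinProjectiveDimension_eq_zero {R : Type u} [Ring R]
    (h : ∀ (M : Type u) [AddCommGroup M] [Module R M], IsGorensteinProjective R M)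
    (M : Type u) [AddCommGroup M] [Module R M] : gorensteinProjectiveDimension R M = 0 := by
  have h0 : HasGorensteinProjectiveDimensionLE R M 0 := by
    refine ⟨fun i ↦ match i with
      | 0 => ModuleCat.of R M
      | _ + 1 => ModuleCat.of R PUnit, fun i ↦ 0, LinearMap.id, fun i ↦ h _, fun i hi ↦ ?_,
      fun i ↦ ?_, ?_, fun x ↦ ⟨x, rfl⟩⟩
    · obtain _ | i := i
      · omega
      · exact (inferInstance : Subsingleton PUnit)
    · exact fun (x : PUnit) ↦ ⟨fun _ ↦ ⟨0, rfl⟩, fun _ ↦ by simp⟩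
    · exact fun (x : M) ↦ by simp [eq_comm]
  exact nonpos_iff_eq_zero.mp (iInf₂_le 0 h0)

/-! ### Global dimensions -/

open CategoryTheory in
/-- If all projective dimensions are at most `n`, so are all injective dimensions; then every module
is injective, and hence every module is projective. -/
theorem leftGlobalDimension_eq_zero_or_top {R : Type u} [Ring R] [IsSemiprimaryRing R]
    (hR : ∀ (C : Type u) [AddCommGroup C] [Module R C], IsSimpleModule R C →
      ∃ I : Ideal R, Nonempty (C ≃ₗ[R] I)) :
    leftGlobalDimension R = 0 ∨ leftGlobalDimension R = ⊤ := by
  refine or_iff_not_imp_right.mpr fun htop ↦ ?_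
  obtain ⟨n, hn⟩ := ENat.ne_top_iff_exists.mp htop
  have hpd (M : ModuleCat.{u} R) : HasProjectiveDimensionLE M n := by
    rw [← projectiveDimension_le_iff]
    have h := le_iSup (fun M : ModuleCat.{u} R ↦ (projectiveDimension M).unbotD 0) M
    rw [← leftGlobalDimension, ← hn] at h
    exact (WithBot.unbotD_le_iff (by simp)).mp h
  have hinj (N : ModuleCat.{u} R) : Injective N := by
    have hN : HasInjectiveDimensionLT N (n + 1) := by
      rw [hasInjectiveDimensionLT_iff]
      intro i hi Y e
      have := hpd Y
      exact e.eq_zero_of_hasProjectiveDimensionLT (n + 1) hi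
    have := injective_of_hasInjectiveDimensionLT hR n N hN
    exact Module.injective_object_of_injective_module R N
  have hproj (M : ModuleCat.{u} R) : HasProjectiveDimensionLE M 0 := by
    rw [← projective_iff_hasProjectiveDimensionLE_zero, projective_iff_subsingleton_ext_one]
    intro N
    have := hinj N
    exact subsingleton_of_forall_eq 0 Abelian.Ext.eq_zero_of_injective
  rw [← nonpos_iff_eq_zero]
  refine iSup_le fun M ↦ (WithBot.unbotD_le_iff (by simp)).mpr ?_
  exact_mod_cast (projectiveDimension_le_iff M 0).mpr (hproj M)

open CategoryTheory in
/-- If all Gorenstein projective dimensions are at most `n`, projective modules have injective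
dimension at most `n`; then they are injective, and every module is Gorenstein projective. -/
theorem leftGorensteinGlobalDimension_eq_zero_or_top {R : Type u} [Ring R] [IsSemiprimaryRing R]
    (hR : ∀ (C : Type u) [AddCommGroup C] [Module R C], IsSimpleModule R C →
      ∃ I : Ideal R, Nonempty (C ≃ₗ[R] I)) :
    leftGorensteinGlobalDimension R = 0 ∨ leftGorensteinGlobalDimension R = ⊤ := by
  refine or_iff_not_imp_right.mpr fun htop ↦ ?_
  obtain ⟨n, hn⟩ := ENat.ne_top_iff_exists.mp htop
  have hgpd (M : ModuleCat.{u} R) : HasGorensteinProjectiveDimensionLE R M n := by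
    apply hasGorensteinProjectiveDimensionLE_of_gorensteinProjectiveDimension_le
    rw [hn]
    exact le_iSup (fun M : ModuleCat.{u} R ↦ gorensteinProjectiveDimension R M) M
  have hinj (Q : Type u) [AddCommGroup Q] [Module R Q] (hQ : Module.Projective R Q) :
      Module.Injective R Q := by
    refine injective_of_hasInjectiveDimensionLT hR n (ModuleCat.of R Q) ?_
    have : Module.Projective R (ModuleCat.of R Q) := hQ
    rw [hasInjectiveDimensionLT_iff]
    intro i hi Y e
    exact ((hgpd Y).subsingleton_ext (ModuleCat.of R Q) i hi).elim e 0
  have hGP (M : Type u) [AddCommGroup M] [Module R M] : IsGorensteinProjective R M :=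
    isGorensteinProjective_of_projective_injective hinj
      (fun M _ _ ↦ exists_injective_linearMap_to_projective hR hinj M) M
  have h0 (M : ModuleCat.{u} R) : gorensteinProjectiveDimension R M = 0 :=
    gorensteinProjectiveDimension_eq_zero hGP M
  simp [leftGorensteinGlobalDimension, h0]

theorem mainTheorem4 (R : Type u) [Ring R] [IsSemiprimaryRing R]
    (hR : ∀ (C : Type u) [AddCommGroup C] [Module R C], IsSimpleModule R C →
      ∃ I : Ideal R, Nonempty (C ≃ₗ[R] I)) :
    (leftGlobalDimension R = 0 ∨ leftGlobalDimension R = ⊤) ∧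
      (leftGorensteinGlobalDimension R = 0 ∨ leftGorensteinGlobalDimension R = ⊤) := by
  exact ⟨leftGlobalDimension_eq_zero_or_top hR,
    leftGorensteinGlobalDimension_eq_zero_or_top hR⟩
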